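/- **Theorem ($\chi$-Birkhoff theorem).** Let $\chi$ be a propositional formula in which at most one atomic proposition $p$ occurs. Define $\chi^0=p$ and $\chi^{k+1}=\chi[\chi^k/p]$, and let $n$ be the Ruitenburg index of $\chi$, i.e. the least $n$ such that $\chi^n\leftrightarrow\chi^{n+2}$ is a theorem of the intuitionistic propositional calculus. For a Heyting algebra $H$, let $\boldsymbol{\chi}:H\to H$ be the map sending $a$ to the value of $\chi$ when $p$ is interpreted as $a$, and let the $\chi$-core of $H$ be $H^\chi=\boldsymbol{\chi}^n[H]$. Call $H$ *core generated* if the only Heyting subalgebra of $H$ containing $H^\chi$ is $H$ itself. Call $K$ a *core superalgebra* of $H$ if (up to isomorphism) $H$ is a subalgebra of $K$ and $H^\chi=K^\chi$. A *variety* is a class of Heyting algebras closed under homomorphic images, subalgebras (up to isomorphism) and arbitrary products. A *$\chi$-variety* is a class of the form $$\mathcal V^\chi=\{K : K \text{ is a core superalgebra of some } H\in\mathcal V\},\qquad \mathcal V \text{ a variety}.$$ A Heyting algebra $A$ is *subdirectly irreducible* if for every embedding of $A$ into a product $\prod_{i\in I}B_i$ with all coordinate maps $A\to B_i$ surjective,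 some coordinate map is an isomorphism ($I=\varnothing$ is allowed, so one-element algebras are excluded). Then every $\chi$-variety $\mathcal X$ is generated, as a $\chi$-variety, by the class $\mathcal X_{CGSI}$ of its members that are both core generated and subdirectly irreducible: $\mathcal X$ is the smallest $\chi$-variety containing $\mathcal X_{CGSI}$. -/

import Mathlib

universe u v

/-- Propositional formulas over a set `AP` of atomic propositions. -/
inductive PropFormula (AP : Type v) : Type v
  | atom : AP → PropFormula AP
  | bot : PropFormula AP
  | and : PropFormula AP → PropFormula AP → PropFormula AP
  | or : PropFormula AP → PropFormula AP → PropFormula AP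
  | imp : PropFormula AP → PropFormula AP → PropFormula AP

namespace PropFormula

variable {AP : Type v}

/-- Biconditional, as an abbreviation. -/
def iff (φ ψ : PropFormula AP) : PropFormula AP := and (imp φ ψ) (imp ψ φ)

/-- The set of atomic propositions that occur in a formula. -/
def vars : PropFormula AP → Set AP
  | atom q => {q}
  | bot => ∅
  | and φ ψ => vars φ ∪ vars ψ
  | or φ ψ => vars φ ∪ vars ψ
  | imp φ ψ => vars φ ∪ vars ψ

/-- Simultaneous substitution of formulas for the atomic propositions. -/
def subst (ρ : AP → PropFormula AP) : PropFormula AP → PropFormula AP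
  | atom q => ρ q
  | bot => bot
  | and φ ψ => and (subst ρ φ) (subst ρ ψ)
  | or φ ψ => or (subst ρ φ) (subst ρ ψ)
  | imp φ ψ => imp (subst ρ φ) (subst ρ ψ)

open Classical in
/-- `φ[ψ/p]`: the formula `ψ` is substituted for the atom `p`, all other atoms are kept. -/
noncomputable def substAtom (p : AP) (φ ψ : PropFormula AP) : PropFormula AP :=
  subst (Function.update atom p ψ) φ

/-- The iterates `φ⁰ = p` and `φⁿ⁺¹ = φ[φⁿ/p]` of a formula `φ` in the atom `p`. -/
noncomputable def iter (p : AP) (φ : PropFormula AP) : ℕ → PropFormula AP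
  | 0 => atom p
  | n + 1 => substAtom p φ (iter p φ n)

/-- Interpretation of a formula in a Heyting algebra under a valuation. -/
def eval {H : Type u} [HeytingAlgebra H] (V : AP → H) : PropFormula AP → H
  | atom q => V q
  | bot => ⊥
  | and φ ψ => eval V φ ⊓ eval V ψ
  | or φ ψ => eval V φ ⊔ eval V ψ
  | imp φ ψ => eval V φ ⇨ eval V ψ

/-- Theorems of the intuitionistic propositional calculus (Hilbert-style axiomatization). -/
inductive IPC : PropFormula AP → Prop
  | imp_intro (φ ψ : PropFormula AP) : IPC (imp φ (imp ψ φ))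
  | imp_distrib (φ ψ θ : PropFormula AP) :
      IPC (imp (imp φ (imp ψ θ)) (imp (imp φ ψ) (imp φ θ)))
  | and_left (φ ψ : PropFormula AP) : IPC (imp (and φ ψ) φ)
  | and_right (φ ψ : PropFormula AP) : IPC (imp (and φ ψ) ψ)
  | and_intro (φ ψ : PropFormula AP) : IPC (imp φ (imp ψ (and φ ψ)))
  | or_left (φ ψ : PropFormula AP) : IPC (imp φ (or φ ψ))
  | or_right (φ ψ : PropFormula AP) : IPC (imp ψ (or φ ψ))
  | or_elim (φ ψ θ : PropFormula AP) :
      IPC (imp (imp φ θ) (imp (imp ψ θ) (imp (or φ ψ) θ)))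
  | bot_elim (φ : PropFormula AP) : IPC (imp bot φ)
  | mp {φ ψ : PropFormula AP} : IPC φ → IPC (imp φ ψ) → IPC ψ

/-- The Ruitenburg index of `φ` with respect to the atom `p`: the smallest `n` such that
`φⁿ ↔ φⁿ⁺²` is a theorem of the intuitionistic propositional calculus. -/
noncomputable def ruitenburgIndex (p : AP) (φ : PropFormula AP) : ℕ :=
  sInf {n : ℕ | IPC (iff (iter p φ n) (iter p φ (n + 2)))}

/-- The polynomial `H → H` of a univariate formula `χ`: its value at `a` is the interpretation
of `χ` under a valuation that sends the only atom of `χ` to `a`. The value of the valuation at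
atoms that do not occur in `χ` is irrelevant; it is also taken to be `a`. -/
def poly (χ : PropFormula AP) (H : Type u) [HeytingAlgebra H] : H → H :=
  fun a => eval (fun _ => a) χ

/-- The `χ`-core of `H`: the image of `H` under the `n`-th iterate of the polynomial of `χ`,
with `n` the Ruitenburg index of `χ`. -/
noncomputable def core (p : AP) (χ : PropFormula AP) (H : Type u) [HeytingAlgebra H] : Set H :=
  Set.range (χ.poly H)^[χ.ruitenburgIndex p]

end PropFormula

/-- The underlying sets of the subalgebras of a Heyting algebra. -/
structure IsHeytingSubalgebra {H : Type u} [HeytingAlgebra H] (S : Set H) : Prop where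
  bot_mem : ⊥ ∈ S
  top_mem : ⊤ ∈ S
  inf_mem : ∀ a ∈ S, ∀ b ∈ S, a ⊓ b ∈ S
  sup_mem : ∀ a ∈ S, ∀ b ∈ S, a ⊔ b ∈ S
  himp_mem : ∀ a ∈ S, ∀ b ∈ S, a ⇨ b ∈ S

/-- The subalgebra of a Heyting algebra generated by a set. -/
def heytingClosure {H : Type u} [HeytingAlgebra H] (T : Set H) : Set H :=
  ⋂₀ {S : Set H | IsHeytingSubalgebra S ∧ T ⊆ S}

/-- A variety: a class of Heyting algebras that is closed under homomorphic images,
(isomorphic copies of) subalgebras, and arbitrary products. -/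
structure IsHeytingVariety (𝒱 : Set HeytAlg.{u}) : Prop where
  homImage : ∀ (A B : HeytAlg.{u}) (f : HeytingHom A B),
    A ∈ 𝒱 → Function.Surjective f → B ∈ 𝒱
  subalgebra : ∀ (A B : HeytAlg.{u}) (f : HeytingHom B A),
    A ∈ 𝒱 → Function.Injective f → B ∈ 𝒱
  product : ∀ (ι : Type u) (A : ι → HeytAlg.{u}),
    (∀ i, A i ∈ 𝒱) → HeytAlg.of (∀ i, A i) ∈ 𝒱

/-- A Heyting algebra `A` is subdirectly irreducible if, for every subdirect embedding of `A` into
a product of Heyting algebras, one of the coordinate projections is an isomorphism on `A`.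
The empty product is allowed, so a one-element algebra is not subdirectly irreducible. -/
def IsSubdirectlyIrreducible (A : HeytAlg.{u}) : Prop :=
  ∀ (ι : Type u) (B : ι → HeytAlg.{u}) (f : ∀ i, HeytingHom A (B i)),
    (∀ i, Function.Surjective (f i)) →
    Function.Injective (fun (a : A) (i : ι) => f i a) →
    ∃ i, Function.Bijective (f i)

section Chi

variable {AP : Type v} (p : AP) (χ : PropFormula AP)

/-- `K` is (up to isomorphism) a core superalgebra of `H`: `H` is a subalgebra of `K` and
the two algebras have the same `χ`-core. -/
def IsCoreSuperalgebra (H K : HeytAlg.{u}) : Prop :=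
  ∃ f : HeytingHom H K, Function.Injective f ∧ f '' (χ.core p H) = χ.core p K

/-- The `χ`-closure of a class of Heyting algebras: all core superalgebras of its members. -/
def chiClosure (𝒱 : Set HeytAlg.{u}) : Set HeytAlg.{u} :=
  {K | ∃ H ∈ 𝒱, IsCoreSuperalgebra p χ H K}

/-- A `χ`-variety is the `χ`-closure of a variety. -/
def IsChiVariety (𝒳 : Set HeytAlg.{u}) : Prop :=
  ∃ 𝒱 : Set HeytAlg.{u}, IsHeytingVariety 𝒱 ∧ 𝒳 = chiClosure p χ 𝒱

/-- `H` is core generated if it is generated, as a Heyting algebra, by its `χ`-core. -/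
def IsCoreGenerated (H : HeytAlg.{u}) : Prop :=
  heytingClosure (χ.core p H) = Set.univ

/-- The core generated subdirectly irreducible members of a class of Heyting algebras. -/
def coreGenSubdirIrred (𝒳 : Set HeytAlg.{u}) : Set HeytAlg.{u} :=
  {H | H ∈ 𝒳 ∧ IsCoreGenerated p χ H ∧ IsSubdirectlyIrreducible H}

end Chi

/-! Let `𝒳` and `𝒴` be the `χ`-closures of varieties `𝒱` and `𝒲`, with the core generated
subdirectly irreducible members of `𝒳` lying in `𝒴`. If `K` is a core superalgebra of `H ∈ 𝒱`, let
`G` be the subalgebra of `H` generated by its core. Then `G ∈ 𝒱` is core generated and has the same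
core as `H`, so `K` is a core superalgebra of `G`, and `G ∈ 𝒲` suffices. By Birkhoff, `G` embeds in
a product of subdirectly irreducible quotients `B`. Each `B` is in `𝒱` and again core generated,
hence in `𝒴`. A core generated member of `𝒴` is already in `𝒲`
(`IsHeytingVariety.mem_of_mem_chiClosure`), so `G ∈ 𝒲`. That `G` and `H` have the same core rests on
Ruitenburg's theorem: the core is the set of solutions of `χ(χ(a)) = a` (`mem_core_iff`), a
condition that does not depend on the ambient algebra. -/

/-! ### Heyting algebras from Heyting preorders -/

/-- A preorder with finite meets, finite joins and relative pseudocomplements, given up to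
equivalence. -/
structure HeytingPreorder (α : Type u) where
  /-- The preorder. -/
  le : α → α → Prop
  /-- A meet. -/
  inf : α → α → α
  /-- A join. -/
  sup : α → α → α
  /-- A relative pseudocomplement. -/
  himp : α → α → α
  /-- A greatest element. -/
  top : α
  /-- A least element. -/
  bot : α
  refl : ∀ a, le a a
  trans : ∀ {a b c}, le a b → le b c → le a c
  inf_le_left : ∀ a b, le (inf a b) a
  inf_le_right : ∀ a b, le (inf a b) b
  le_inf : ∀ {a b c}, le a b → le a c → le a (inf b c)
  le_sup_left : ∀ a b, le a (sup a b)
  le_sup_right : ∀ a b, le b (sup a b)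
  sup_le : ∀ {a b c}, le a c → le b c → le (sup a b) c
  le_top : ∀ a, le a top
  bot_le : ∀ a, le bot a
  le_himp_iff : ∀ {a b c}, le a (himp b c) ↔ le (inf a b) c

namespace HeytingPreorder

variable {α : Type u} (P : HeytingPreorder α)

/-- Equivalence in a Heyting preorder. -/
def setoid : Setoid α where
  r a b := P.le a b ∧ P.le b a
  iseqv := ⟨fun a => ⟨P.refl a, P.refl a⟩, fun h => ⟨h.2, h.1⟩,
    fun h k => ⟨P.trans h.1 k.1, P.trans k.2 h.2⟩⟩

/-- The quotient of a Heyting preorder by its equivalence. -/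
def Quot : Type u := Quotient P.setoid

/-- The class of an element. -/
def cls (a : α) : P.Quot := Quotient.mk P.setoid a

theorem cls_surjective : Function.Surjective P.cls := Quotient.exists_rep

theorem inf_mono {a b c d : α} (h : P.le a b) (k : P.le c d) : P.le (P.inf a c) (P.inf b d) :=
  P.le_inf (P.trans (P.inf_le_left _ _) h) (P.trans (P.inf_le_right _ _) k)

theorem sup_mono {a b c d : α} (h : P.le a b) (k : P.le c d) : P.le (P.sup a c) (P.sup b d) :=
  P.sup_le (P.trans h (P.le_sup_left _ _)) (P.trans k (P.le_sup_right _ _))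

theorem himp_mono {a b c d : α} (h : P.le b a) (k : P.le c d) :
    P.le (P.himp a c) (P.himp b d) :=
  P.le_himp_iff.2 <| P.trans (P.inf_mono (P.refl _) h) <|
    P.trans (P.le_himp_iff.1 (P.refl _)) k

/-- Serves both the Lindenbaum algebra and the quotients by filters. -/
instance : HeytingAlgebra P.Quot where
  le := Quotient.lift₂ P.le fun _ _ _ _ h k => propext
    ⟨fun l => P.trans h.2 (P.trans l k.1), fun l => P.trans h.1 (P.trans l k.2)⟩
  le_refl := by rintro ⟨a⟩; exact P.refl a
  le_trans := by rintro ⟨a⟩ ⟨b⟩ ⟨c⟩ h k; exact P.trans h k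
  le_antisymm := by rintro ⟨a⟩ ⟨b⟩ h k; exact Quotient.sound ⟨h, k⟩
  inf := Quotient.map₂ P.inf fun _ _ h _ _ k => ⟨P.inf_mono h.1 k.1, P.inf_mono h.2 k.2⟩
  inf_le_left := by rintro ⟨a⟩ ⟨b⟩; exact P.inf_le_left a b
  inf_le_right := by rintro ⟨a⟩ ⟨b⟩; exact P.inf_le_right a b
  le_inf := by rintro ⟨a⟩ ⟨b⟩ ⟨c⟩ h k; exact P.le_inf h k
  sup := Quotient.map₂ P.sup fun _ _ h _ _ k => ⟨P.sup_mono h.1 k.1, P.sup_mono h.2 k.2⟩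
  le_sup_left := by rintro ⟨a⟩ ⟨b⟩; exact P.le_sup_left a b
  le_sup_right := by rintro ⟨a⟩ ⟨b⟩; exact P.le_sup_right a b
  sup_le := by rintro ⟨a⟩ ⟨b⟩ ⟨c⟩ h k; exact P.sup_le h k
  top := P.cls P.top
  le_top := by rintro ⟨a⟩; exact P.le_top a
  bot := P.cls P.bot
  bot_le := by rintro ⟨a⟩; exact P.bot_le a
  himp := Quotient.map₂ P.himp fun _ _ h _ _ k => ⟨P.himp_mono h.2 k.1, P.himp_mono h.1 k.2⟩
  le_himp_iff := by rintro ⟨a⟩ ⟨b⟩ ⟨c⟩; exact P.le_himp_iff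
  compl := Quotient.map (fun a => P.himp a P.bot)
    fun _ _ h => ⟨P.himp_mono h.2 (P.refl _), P.himp_mono h.1 (P.refl _)⟩
  himp_bot := by rintro ⟨a⟩; rfl

theorem cls_le_cls {a b : α} : P.cls a ≤ P.cls b ↔ P.le a b := Iff.rfl

end HeytingPreorder

/-! ### Formulas and their polynomials -/

namespace PropFormula

variable {AP : Type v}

theorem eval_congr {H : Type u} [HeytingAlgebra H] {V W : AP → H} (φ : PropFormula AP)
    (h : ∀ q ∈ φ.vars, V q = W q) : eval V φ = eval W φ := by
  induction φ with
  | atom q => exact h q rfl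
  | bot => rfl
  | and φ ψ hφ hψ | or φ ψ hφ hψ | imp φ ψ hφ hψ =>
    simp only [eval, hφ fun q hq => h q (Or.inl hq), hψ fun q hq => h q (Or.inr hq)]

theorem eval_subst {H : Type u} [HeytingAlgebra H] (V : AP → H) (ρ : AP → PropFormula AP)
    (φ : PropFormula AP) : eval V (subst ρ φ) = eval (fun q => eval V (ρ q)) φ := by
  induction φ with
  | atom q => rfl
  | bot => rfl
  | and φ ψ hφ hψ | or φ ψ hφ hψ | imp φ ψ hφ hψ => simp only [subst, eval, hφ, hψ]

theorem map_eval {H K : Type*} [HeytingAlgebra H] [HeytingAlgebra K] (f : HeytingHom H K)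
    (V : AP → H) (φ : PropFormula AP) : f (eval V φ) = eval (fun q => f (V q)) φ := by
  induction φ with
  | atom q => rfl
  | bot => exact map_bot f
  | and φ ψ hφ hψ | or φ ψ hφ hψ | imp φ ψ hφ hψ => simp [eval, hφ, hψ]

theorem eval_iter {H : Type u} [HeytingAlgebra H] (V : AP → H) {p : AP} {χ : PropFormula AP}
    (hχ : χ.vars ⊆ {p}) (n : ℕ) : eval V (iter p χ n) = (χ.poly H)^[n] (V p) := by
  induction n with
  | zero => rfl
  | succ n ih =>
    rw [Function.iterate_succ_apply', ← ih, iter, substAtom, eval_subst]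
    refine eval_congr _ fun q hq => ?_
    obtain rfl : q = p := hχ hq
    simp

theorem IPC.eval_eq_top {H : Type u} [HeytingAlgebra H] (V : AP → H) {φ : PropFormula AP}
    (h : IPC φ) : eval V φ = ⊤ := by
  induction h with
  | imp_intro φ ψ => simp [eval]
  | imp_distrib φ ψ θ =>
    simp only [eval, himp_eq_top_iff, le_himp_iff]
    set a := eval V φ
    set b := eval V ψ
    set c := eval V θ
    have h₁ : (a ⇨ b ⇨ c) ⊓ (a ⇨ b) ⊓ a ≤ b :=
      (inf_le_inf_right a inf_le_right).trans himp_inf_le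
    have h₂ : (a ⇨ b ⇨ c) ⊓ (a ⇨ b) ⊓ a ≤ b ⇨ c :=
      (inf_le_inf_right a inf_le_left).trans himp_inf_le
    exact (le_inf h₂ h₁).trans himp_inf_le
  | and_left φ ψ => simp [eval]
  | and_right φ ψ => simp [eval]
  | and_intro φ ψ => simp [eval]
  | or_left φ ψ => simp [eval]
  | or_right φ ψ => simp [eval]
  | or_elim φ ψ θ =>
    simp only [eval, himp_eq_top_iff, le_himp_iff]
    rw [← sup_himp_distrib]
    exact himp_inf_le
  | bot_elim φ => simp [eval]
  | mp _ _ hφ hψ => simpa [eval, hφ] using hψ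

/-! ### Hilbert-style derivations and the Lindenbaum algebra. -/

namespace IPC

theorem imp_self (φ : PropFormula AP) : IPC (imp φ φ) :=
  mp (imp_intro φ φ) (mp (imp_intro φ (imp φ φ)) (imp_distrib φ (imp φ φ) φ))

theorem weaken {φ ψ : PropFormula AP} (h : IPC ψ) : IPC (imp φ ψ) := mp h (imp_intro _ _)

theorem mp_under {φ ψ θ : PropFormula AP} (h : IPC (imp φ ψ)) (k : IPC (imp φ (imp ψ θ))) :
    IPC (imp φ θ) :=
  mp h (mp k (imp_distrib _ _ _))

theorem imp_trans {φ ψ θ : PropFormula AP} (h : IPC (imp φ ψ)) (k : IPC (imp ψ θ)) :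
    IPC (imp φ θ) :=
  mp_under h (weaken k)

theorem imp_and {φ ψ θ : PropFormula AP} (h : IPC (imp φ ψ)) (k : IPC (imp φ θ)) :
    IPC (imp φ (and ψ θ)) :=
  mp_under k (mp_under h (weaken (and_intro _ _)))

theorem imp_imp_iff {φ ψ θ : PropFormula AP} :
    IPC (imp φ (imp ψ θ)) ↔ IPC (imp (and φ ψ) θ) := by
  refine ⟨fun h => mp_under (and_right _ _) (imp_trans (and_left _ _) h), fun h => ?_⟩
  exact imp_trans (and_intro φ ψ) (mp (weaken h) (imp_distrib _ _ _))

end IPC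

variable (AP) in
/-- Derivability as a Heyting preorder on formulas; its quotient is the Lindenbaum algebra. -/
def derivability : HeytingPreorder (PropFormula AP) where
  le φ ψ := IPC (imp φ ψ)
  inf := and
  sup := or
  himp := imp
  top := imp bot bot
  bot := bot
  refl := IPC.imp_self
  trans := IPC.imp_trans
  inf_le_left := IPC.and_left
  inf_le_right := IPC.and_right
  le_inf := IPC.imp_and
  le_sup_left := IPC.or_left
  le_sup_right := IPC.or_right
  sup_le h k := IPC.mp k (IPC.mp h (IPC.or_elim _ _ _))
  le_top _ := IPC.weaken (IPC.imp_self _)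
  bot_le := IPC.bot_elim
  le_himp_iff := IPC.imp_imp_iff

theorem eval_derivability (φ : PropFormula AP) :
    eval (fun q => (derivability AP).cls (atom q)) φ = (derivability AP).cls φ := by
  induction φ with
  | atom q => rfl
  | bot => rfl
  | and φ ψ hφ hψ | or φ ψ hφ hψ | imp φ ψ hφ hψ => rw [eval, hφ, hψ]; rfl

/-- Completeness of the calculus for biconditionals. -/
theorem IPC.iff_of_eval_eq {φ ψ : PropFormula AP}
    (h : ∀ (H : Type v) [HeytingAlgebra H] (V : AP → H), eval V φ = eval V ψ) :
    IPC (iff φ ψ) := by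
  have h := h _ fun q => (derivability AP).cls (atom q)
  rw [eval_derivability, eval_derivability] at h
  exact IPC.mp ((derivability AP).cls_le_cls.1 h.ge)
    (IPC.mp ((derivability AP).cls_le_cls.1 h.le) (IPC.and_intro _ _))

/-! ### Ruitenburg's theorem in one variable. -/

theorem himp_inf_relative {H : Type u} [HeytingAlgebra H] (a b c : H) :
    (a ⇨ b) ⊓ c = ((a ⊓ c) ⇨ (b ⊓ c)) ⊓ c := by
  apply le_antisymm
  · refine le_inf (le_himp_iff.2 (le_inf ?_ (inf_le_left.trans inf_le_right))) inf_le_right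
    exact (inf_le_inf inf_le_left inf_le_left).trans himp_inf_le
  · refine le_inf (le_himp_iff.2 ?_) inf_le_right
    rw [inf_assoc, inf_comm c a]
    exact himp_inf_le.trans inf_le_left

/-- Meeting with `c` is a homomorphism onto the interval below `c`; `himp_inf_relative` is the case
of implication. -/
theorem poly_inf_congr (χ : PropFormula AP) {H : Type u} [HeytingAlgebra H] {a b c : H}
    (h : a ⊓ c = b ⊓ c) : χ.poly H a ⊓ c = χ.poly H b ⊓ c := by
  unfold poly
  induction χ with
  | atom q => exact h
  | bot => rfl
  | and φ ψ hφ hψ =>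
    rw [eval, eval, inf_inf_distrib_right, hφ, hψ, ← inf_inf_distrib_right]
  | or φ ψ hφ hψ => rw [eval, eval, inf_sup_right, hφ, hψ, ← inf_sup_right]
  | imp φ ψ hφ hψ => rw [eval, eval, himp_inf_relative, hφ, hψ, ← himp_inf_relative]

theorem poly_bot (χ : PropFormula AP) (H : Type u) [HeytingAlgebra H] :
    χ.poly H ⊥ = ⊥ ∨ χ.poly H ⊥ = ⊤ := by
  unfold poly
  induction χ with
  | atom q => exact Or.inl rfl
  | bot => exact Or.inl rfl
  | and φ ψ hφ hψ | or φ ψ hφ hψ | imp φ ψ hφ hψ =>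
    rcases hφ with h | h <;> rcases hψ with k | k <;> simp [eval, h, k]

/-- Below `aᶜᶜ` the element `a` is dense, so a polynomial takes one of three values there. -/
theorem poly_inf_compl_compl (χ : PropFormula AP) (H : Type u) [HeytingAlgebra H] :
    (∀ a, χ.poly H a ⊓ aᶜᶜ = ⊥) ∨ (∀ a, χ.poly H a ⊓ aᶜᶜ = a) ∨
      (∀ a, χ.poly H a ⊓ aᶜᶜ = aᶜᶜ) := by
  -- `⊥`, `a` and `aᶜᶜ` are closed under the operations of the interval below `aᶜᶜ`; this is the
  -- implication from its top to `a`.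
  have dense (a : H) : (aᶜᶜ ⇨ a) ⊓ aᶜᶜ = a := by
    rw [himp_inf_self, inf_eq_left.2 le_compl_compl]
  induction χ with
  | atom q => exact Or.inr (Or.inl fun a => inf_eq_left.2 le_compl_compl)
  | bot => exact Or.inl fun a => bot_inf_eq _
  | and φ ψ hφ hψ =>
    have key (a : H) : (and φ ψ).poly H a ⊓ aᶜᶜ =
        (φ.poly H a ⊓ aᶜᶜ) ⊓ (ψ.poly H a ⊓ aᶜᶜ) := inf_inf_distrib_right _ _ _
    simp only [key]
    rcases hφ with h | h | h <;> rcases hψ with k | k | k <;> simp [h, k, le_compl_compl]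
  | or φ ψ hφ hψ =>
    have key (a : H) : (or φ ψ).poly H a ⊓ aᶜᶜ =
        (φ.poly H a ⊓ aᶜᶜ) ⊔ (ψ.poly H a ⊓ aᶜᶜ) := inf_sup_right _ _ _
    simp only [key]
    rcases hφ with h | h | h <;> rcases hψ with k | k | k <;> simp [h, k, le_compl_compl]
  | imp φ ψ hφ hψ =>
    have key (a : H) : (imp φ ψ).poly H a ⊓ aᶜᶜ =
        ((φ.poly H a ⊓ aᶜᶜ) ⇨ (ψ.poly H a ⊓ aᶜᶜ)) ⊓ aᶜᶜ := himp_inf_relative _ _ _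
    simp only [key]
    rcases hφ with h | h | h <;> rcases hψ with k | k | k <;>
      simp [h, k, dense, himp_eq_top_iff.2 le_compl_compl]

/-- Ruitenburg's theorem for polynomials in one variable. -/
theorem poly_iterate_two (χ : PropFormula AP) (H : Type u) [HeytingAlgebra H] :
    (χ.poly H)^[2] = (χ.poly H)^[4] := by
  have three := χ.poly_inf_compl_compl H
  have hbot (a : H) : χ.poly H a ⊓ aᶜ = χ.poly H ⊥ ⊓ aᶜ := χ.poly_inf_congr (by simp)
  have htop (a : H) : χ.poly H a ⊓ a = χ.poly H ⊤ ⊓ a := χ.poly_inf_congr (by simp)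
  have bot_cases := χ.poly_bot H
  have top_cases : χ.poly H ⊤ = ⊥ ∨ χ.poly H ⊤ = ⊤ := by
    rcases three with h | h | h
    · exact Or.inl (by simpa using h ⊤)
    · exact Or.inr (by simpa using h ⊤)
    · exact Or.inr (by simpa using h ⊤)
  generalize χ.poly H = f at *
  funext a
  change f (f a) = f (f (f (f a)))
  rcases top_cases with t | t
  -- `f a` is disjoint from `a`, so `f` is constantly `⊥` or is the complement.
  · have hle (a : H) : f a = f ⊥ ⊓ aᶜ := by
      rw [← hbot, eq_comm, inf_eq_left, le_compl_iff_disjoint_right, disjoint_iff, htop, t,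
        bot_inf_eq]
    rcases bot_cases with b | b <;> simp only [b, bot_inf_eq, top_inf_eq] at hle <;> simp [hle]
  · have hle (a : H) : a ≤ f a := by simpa [t] using htop a
    rcases bot_cases with b | b
    -- `f a` is disjoint from `aᶜ`, so the three cases describe `f` itself.
    · have hle' (a : H) : f a ≤ aᶜᶜ := by
        rw [le_compl_iff_disjoint_right, disjoint_iff, hbot, b, bot_inf_eq]
      have eq (a : H) : f a ⊓ aᶜᶜ = f a := inf_eq_left.2 (hle' a)
      simp only [eq] at three
      rcases three with h | h | h <;> simp [h]
    -- `f a` lies above `a` and `aᶜ`, hence is dense; the three cases at `f a` therefore describe `f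
    -- (f a)`.
    · have hd (a : H) : (f a)ᶜᶜ = ⊤ := by
        have h : aᶜ ≤ f a := by simpa [b] using hbot a
        have : (f a)ᶜ ≤ ⊥ := by
          rw [← inf_compl_self aᶜ]
          exact le_inf (compl_le_compl (hle a)) (compl_le_compl h)
        rw [le_bot_iff.1 this, compl_bot]
      have eq (a : H) : f (f a) ⊓ (f a)ᶜᶜ = f (f a) := by rw [hd, inf_top_eq]
      have three : (∀ a, f (f a) = ⊥) ∨ (∀ a, f (f a) = f a) ∨ (∀ a, f (f a) = ⊤) := by
        refine three.imp ?_ (Or.imp ?_ ?_) <;> intro h a <;> simpa [eq, hd] using h (f a)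
      rcases three with h | h | h <;> simp [h]

/-- The Ruitenburg index is attained. -/
theorem ruitenburgIndex_spec {p : AP} {χ : PropFormula AP} (hχ : χ.vars ⊆ {p}) :
    IPC (iff (iter p χ (χ.ruitenburgIndex p)) (iter p χ (χ.ruitenburgIndex p + 2))) := by
  -- Without a witness the infimum would be the default value `0`; `poly_iterate_two` supplies `2`.
  refine Nat.sInf_mem
    (s := {n : ℕ | IPC (iff (iter p χ n) (iter p χ (n + 2)))}) ⟨2, IPC.iff_of_eval_eq ?_⟩
  intro H _ V
  rw [eval_iter V hχ, eval_iter V hχ, poly_iterate_two]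

theorem poly_iterate_ruitenburgIndex {p : AP} {χ : PropFormula AP} (hχ : χ.vars ⊆ {p})
    {H : Type u} [HeytingAlgebra H] (a : H) :
    (χ.poly H)^[χ.ruitenburgIndex p + 2] a = (χ.poly H)^[χ.ruitenburgIndex p] a := by
  have h := (ruitenburgIndex_spec hχ).eval_eq_top fun _ => a
  simp only [iff, eval, eval_iter _ hχ, inf_eq_top_iff, himp_eq_top_iff] at h
  exact le_antisymm h.2 h.1

/-! ### Cores -/

/-- Turns the existential definition of the core into an equation, which subalgebras reflect. -/
theorem mem_core_iff {p : AP} {χ : PropFormula AP} (hχ : χ.vars ⊆ {p})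
    {H : Type u} [HeytingAlgebra H] {a : H} :
    a ∈ χ.core p H ↔ χ.poly H (χ.poly H a) = a := by
  constructor
  · rintro ⟨b, rfl⟩
    rw [← Function.iterate_succ_apply' (χ.poly H), ← Function.iterate_succ_apply' (χ.poly H)]
    exact poly_iterate_ruitenburgIndex hχ b
  · intro h
    -- In total `2n` applications, that is `n` of the square, which fixes `a`.
    refine ⟨(χ.poly H)^[χ.ruitenburgIndex p] a, ?_⟩
    rw [← Function.iterate_add_apply, ← two_mul, Function.iterate_mul]
    exact Function.iterate_fixed h _

theorem map_poly (χ : PropFormula AP) {H K : Type*} [HeytingAlgebra H] [HeytingAlgebra K]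
    (f : HeytingHom H K) (a : H) : f (χ.poly H a) = χ.poly K (f a) :=
  map_eval f _ χ

theorem map_mem_core {p : AP} {χ : PropFormula AP} {H K : Type u} [HeytingAlgebra H]
    [HeytingAlgebra K] (f : HeytingHom H K) {a : H} (h : a ∈ χ.core p H) :
    f a ∈ χ.core p K := by
  obtain ⟨b, rfl⟩ := h
  exact ⟨f b, ((Function.Semiconj.iterate_right (χ.map_poly f) _) b).symm⟩

end PropFormula

/-! ### Subalgebras -/

namespace IsHeytingSubalgebra

variable {H K : Type u} [HeytingAlgebra H] [HeytingAlgebra K]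

theorem heytingClosure (T : Set H) : IsHeytingSubalgebra (heytingClosure T) where
  bot_mem _ hS := hS.1.bot_mem
  top_mem _ hS := hS.1.top_mem
  inf_mem _ ha _ hb S hS := hS.1.inf_mem _ (ha S hS) _ (hb S hS)
  sup_mem _ ha _ hb S hS := hS.1.sup_mem _ (ha S hS) _ (hb S hS)
  himp_mem _ ha _ hb S hS := hS.1.himp_mem _ (ha S hS) _ (hb S hS)

theorem preimage (f : HeytingHom H K) {S : Set K} (hS : IsHeytingSubalgebra S) :
    IsHeytingSubalgebra (f ⁻¹' S) where
  bot_mem := by simpa using hS.bot_mem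
  top_mem := by simpa using hS.top_mem
  inf_mem a ha b hb := by simpa using hS.inf_mem _ ha _ hb
  sup_mem a ha b hb := by simpa using hS.sup_mem _ ha _ hb
  himp_mem a ha b hb := by simpa using hS.himp_mem _ ha _ hb

theorem image (f : HeytingHom H K) {S : Set H} (hS : IsHeytingSubalgebra S) :
    IsHeytingSubalgebra (f '' S) where
  bot_mem := ⟨⊥, hS.bot_mem, map_bot f⟩
  top_mem := ⟨⊤, hS.top_mem, map_top f⟩
  inf_mem := by
    rintro _ ⟨a, ha, rfl⟩ _ ⟨b, hb, rfl⟩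
    exact ⟨a ⊓ b, hS.inf_mem a ha b hb, map_inf f a b⟩
  sup_mem := by
    rintro _ ⟨a, ha, rfl⟩ _ ⟨b, hb, rfl⟩
    exact ⟨a ⊔ b, hS.sup_mem a ha b hb, map_sup f a b⟩
  himp_mem := by
    rintro _ ⟨a, ha, rfl⟩ _ ⟨b, hb, rfl⟩
    exact ⟨a ⇨ b, hS.himp_mem a ha b hb, map_himp f a b⟩

theorem univ : IsHeytingSubalgebra (Set.univ : Set H) where
  bot_mem := trivial
  top_mem := trivial
  inf_mem _ _ _ _ := trivial
  sup_mem _ _ _ _ := trivial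
  himp_mem _ _ _ _ := trivial

/-- The Heyting algebra structure of a subalgebra. -/
abbrev heytingAlgebra {S : Set H} (hS : IsHeytingSubalgebra S) : HeytingAlgebra S :=
  letI : Max S := ⟨fun a b => ⟨a ⊔ b, hS.sup_mem _ a.2 _ b.2⟩⟩
  letI : Min S := ⟨fun a b => ⟨a ⊓ b, hS.inf_mem _ a.2 _ b.2⟩⟩
  letI : Top S := ⟨⟨⊤, hS.top_mem⟩⟩
  letI : Bot S := ⟨⟨⊥, hS.bot_mem⟩⟩
  letI : HImp S := ⟨fun a b => ⟨a ⇨ b, hS.himp_mem _ a.2 _ b.2⟩⟩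
  letI : Compl S := ⟨fun a => ⟨aᶜ, himp_bot (a : H) ▸ hS.himp_mem _ a.2 _ hS.bot_mem⟩⟩
  Function.Injective.heytingAlgebra (Subtype.val : S → H) Subtype.val_injective Iff.rfl Iff.rfl
    (fun _ _ => rfl) (fun _ _ => rfl) rfl rfl (fun _ => rfl) (fun _ _ => rfl)

/-- A subalgebra of a Heyting algebra, as an object of its own. -/
def toHeytAlg {H : HeytAlg.{u}} {S : Set H} (hS : IsHeytingSubalgebra S) : HeytAlg.{u} :=
  @HeytAlg.of S hS.heytingAlgebra

/-- The inclusion of a subalgebra. -/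
def subtype {H : HeytAlg.{u}} {S : Set H} (hS : IsHeytingSubalgebra S) :
    HeytingHom hS.toHeytAlg H where
  toFun := Subtype.val
  map_sup' _ _ := rfl
  map_inf' _ _ := rfl
  map_bot' := rfl
  map_himp' _ _ := rfl

theorem subtype_injective {H : HeytAlg.{u}} {S : Set H} (hS : IsHeytingSubalgebra S) :
    Function.Injective hS.subtype := Subtype.val_injective

end IsHeytingSubalgebra

theorem subset_heytingClosure {H : Type u} [HeytingAlgebra H] (T : Set H) :
    T ⊆ heytingClosure T := fun _ ha _ hS => hS.2 ha

section CoreGenerated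

variable {AP : Type v} {p : AP} {χ : PropFormula AP}

/-- An iterate's preimage of a core element could lie outside `S`; the equation of `mem_core_iff`
involves only the element itself. -/
theorem image_core_subtype (hχ : χ.vars ⊆ {p}) {H : HeytAlg.{u}} {S : Set H}
    (hS : IsHeytingSubalgebra S) (h : χ.core p H ⊆ S) :
    hS.subtype '' χ.core p hS.toHeytAlg = χ.core p H := by
  apply Set.Subset.antisymm
  · rintro _ ⟨a, ha, rfl⟩
    exact PropFormula.map_mem_core _ ha
  · intro a ha
    obtain ⟨b, rfl⟩ : ∃ b, hS.subtype b = a := ⟨⟨a, h ha⟩, rfl⟩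
    refine ⟨b, ?_, rfl⟩
    rw [PropFormula.mem_core_iff hχ] at ha ⊢
    apply hS.subtype_injective
    rw [PropFormula.map_poly, PropFormula.map_poly]
    exact ha

theorem isCoreGenerated_iff {H : HeytAlg.{u}} : IsCoreGenerated p χ H ↔
    ∀ S : Set H, IsHeytingSubalgebra S → χ.core p H ⊆ S → S = Set.univ := by
  refine ⟨fun h S hS hc => Set.eq_univ_of_univ_subset ?_, fun h => ?_⟩
  · rw [← h]
    exact Set.sInter_subset_of_mem ⟨hS, hc⟩
  · exact h _ (.heytingClosure _) (subset_heytingClosure _)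

theorem isCoreGenerated_heytingClosure_core (hχ : χ.vars ⊆ {p}) (H : HeytAlg.{u}) :
    IsCoreGenerated p χ (IsHeytingSubalgebra.heytingClosure (χ.core p H)).toHeytAlg := by
  set hG := IsHeytingSubalgebra.heytingClosure (χ.core p H)
  refine isCoreGenerated_iff.2 fun S hS hc => Set.eq_univ_of_forall fun a => ?_
  have h : χ.core p H ⊆ hG.subtype '' S :=
    (image_core_subtype hχ hG (subset_heytingClosure _)).ge.trans (Set.image_mono hc)
  obtain ⟨b, hb, e⟩ := a.2 _ ⟨hS.image hG.subtype, h⟩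
  rwa [← hG.subtype_injective e]

theorem IsCoreGenerated.of_surjective {A B : HeytAlg.{u}} (hA : IsCoreGenerated p χ A)
    (f : HeytingHom A B) (hf : Function.Surjective f) : IsCoreGenerated p χ B := by
  refine isCoreGenerated_iff.2 fun S hS hc => ?_
  have h := isCoreGenerated_iff.1 hA _ (hS.preimage f)
    fun a ha => hc (PropFormula.map_mem_core f ha)
  exact Set.preimage_injective.2 hf (by simpa using h)

/-- A core generated algebra is a proper core superalgebra of no algebra. -/
theorem IsCoreGenerated.surjective {H K : HeytAlg.{u}} (hK : IsCoreGenerated p χ K)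
    (f : HeytingHom H K) (hf : f '' χ.core p H = χ.core p K) : Function.Surjective f := by
  rw [← Set.range_eq_univ, ← Set.image_univ]
  exact isCoreGenerated_iff.1 hK _ (IsHeytingSubalgebra.univ.image f)
    (hf ▸ Set.image_mono (Set.subset_univ _))

/-- The embedding of a member of `𝒱` has a range containing the core of `K`, so it is onto and `K`
is a homomorphic image. -/
theorem IsHeytingVariety.mem_of_mem_chiClosure {𝒱 : Set HeytAlg.{u}} (h𝒱 : IsHeytingVariety 𝒱)
    {K : HeytAlg.{u}} (hK : K ∈ chiClosure p χ 𝒱) (hg : IsCoreGenerated p χ K) : K ∈ 𝒱 := by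
  obtain ⟨H, hH, f, -, hf⟩ := hK
  exact h𝒱.homImage H K f hH (hg.surjective f hf)

theorem subset_chiClosure (𝒱 : Set HeytAlg.{u}) : 𝒱 ⊆ chiClosure p χ 𝒱 :=
  fun H hH => ⟨H, hH, HeytingHom.id H, Function.injective_id, Set.image_id _⟩

theorem IsCoreSuperalgebra.trans {H K L : HeytAlg.{u}} (h : IsCoreSuperalgebra p χ H K)
    (k : IsCoreSuperalgebra p χ K L) : IsCoreSuperalgebra p χ H L := by
  obtain ⟨f, hf, hf'⟩ := h
  obtain ⟨g, hg, hg'⟩ := k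
  refine ⟨g.comp f, hg.comp hf, ?_⟩
  rw [← hg', ← hf', Set.image_image]
  rfl

end CoreGenerated

/-! ### Filters and subdirect decompositions -/

/-- The underlying sets of the filters of a Heyting algebra. -/
structure IsHeytingFilter {H : Type u} [HeytingAlgebra H] (F : Set H) : Prop where
  top_mem : ⊤ ∈ F
  inf_mem : ∀ {a b}, a ∈ F → b ∈ F → a ⊓ b ∈ F
  mem_of_le : ∀ {a b}, a ∈ F → a ≤ b → b ∈ F

namespace IsHeytingFilter

/-- The preorder of a Heyting algebra modulo a filter. -/
def heytingPreorder {H : Type u} [HeytingAlgebra H] {F : Set H} (hF : IsHeytingFilter F) :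
    HeytingPreorder H where
  le a b := a ⇨ b ∈ F
  inf := (· ⊓ ·)
  sup := (· ⊔ ·)
  himp := (· ⇨ ·)
  top := ⊤
  bot := ⊥
  refl a := by simpa using hF.top_mem
  trans h k := hF.mem_of_le (hF.inf_mem h k) (himp_triangle _ _ _)
  inf_le_left a b := hF.mem_of_le hF.top_mem (himp_eq_top_iff.2 inf_le_left).ge
  inf_le_right a b := hF.mem_of_le hF.top_mem (himp_eq_top_iff.2 inf_le_right).ge
  le_inf h k := by simpa [himp_inf_distrib] using hF.inf_mem h k
  le_sup_left a b := hF.mem_of_le hF.top_mem (himp_eq_top_iff.2 le_sup_left).ge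
  le_sup_right a b := hF.mem_of_le hF.top_mem (himp_eq_top_iff.2 le_sup_right).ge
  sup_le h k := by simpa [sup_himp_distrib] using hF.inf_mem h k
  le_top a := by simpa using hF.top_mem
  bot_le a := by simpa using hF.top_mem
  le_himp_iff := by simp [himp_himp]

/-- The quotient of a Heyting algebra by a filter. -/
def quotient {H : HeytAlg.{u}} {F : Set H} (hF : IsHeytingFilter F) : HeytAlg.{u} :=
  HeytAlg.of hF.heytingPreorder.Quot

/-- The projection to the quotient by a filter. -/
def proj {H : HeytAlg.{u}} {F : Set H} (hF : IsHeytingFilter F) :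
    HeytingHom H hF.quotient where
  toFun := hF.heytingPreorder.cls
  map_sup' _ _ := rfl
  map_inf' _ _ := rfl
  map_bot' := rfl
  map_himp' _ _ := rfl

theorem proj_surjective {H : HeytAlg.{u}} {F : Set H} (hF : IsHeytingFilter F) :
    Function.Surjective hF.proj := hF.heytingPreorder.cls_surjective

theorem proj_eq_top_iff {H : HeytAlg.{u}} {F : Set H} (hF : IsHeytingFilter F) {a : H} :
    hF.proj a = ⊤ ↔ a ∈ F := by
  rw [eq_top_iff]
  exact hF.heytingPreorder.cls_le_cls.trans (by
    change ⊤ ⇨ a ∈ F ↔ a ∈ F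
    rw [top_himp])

theorem preimage_top {H K : Type u} [HeytingAlgebra H] [HeytingAlgebra K] (f : HeytingHom H K) :
    IsHeytingFilter {a | f a = ⊤} where
  top_mem := map_top f
  inf_mem ha hb := by simp_all
  mem_of_le ha h := top_unique (ha ▸ OrderHomClass.mono f h)

theorem exists_maximal {H : Type u} [HeytingAlgebra H] {c : H} (hc : c ≠ ⊤) :
    ∃ F : Set H, Maximal (fun F => IsHeytingFilter F ∧ c ∉ F) F := by
  have h₀ : IsHeytingFilter ({⊤} : Set H) :=
    ⟨rfl, by rintro _ _ rfl rfl; exact inf_idem _, by rintro _ _ rfl h; exact top_unique h⟩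
  suffices h : ∀ C ⊆ {F : Set H | IsHeytingFilter F ∧ c ∉ F}, IsChain (· ⊆ ·) C → C.Nonempty →
      ∃ ub ∈ {F : Set H | IsHeytingFilter F ∧ c ∉ F}, ∀ s ∈ C, s ⊆ ub by
    obtain ⟨F, -, hF⟩ := zorn_subset_nonempty _ h {⊤} ⟨h₀, hc⟩
    exact ⟨F, hF⟩
  intro C hC hchain hne
  refine ⟨⋃₀ C, ⟨⟨?_, ?_, ?_⟩, ?_⟩, fun s hs => Set.subset_sUnion_of_mem hs⟩
  · obtain ⟨s, hs⟩ := hne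
    exact ⟨s, hs, (hC hs).1.top_mem⟩
  · rintro a b ⟨s, hs, ha⟩ ⟨t, ht, hb⟩
    rcases hchain.total hs ht with h | h
    · exact ⟨t, ht, (hC ht).1.inf_mem (h ha) hb⟩
    · exact ⟨s, hs, (hC hs).1.inf_mem ha (h hb)⟩
  · rintro a b ⟨s, hs, ha⟩ h
    exact ⟨s, hs, (hC hs).1.mem_of_le ha h⟩
  · rintro ⟨s, hs, h⟩
    exact (hC hs).2 h

end IsHeytingFilter

/-- The order is determined by `⊤`, since `a ≤ b` amounts to `a ⇨ b = ⊤`. -/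
theorem HeytingHom.injective_of_eq_top {H K : Type u} [HeytingAlgebra H] [HeytingAlgebra K]
    (f : HeytingHom H K) (h : ∀ a, f a = ⊤ → a = ⊤) : Function.Injective f := by
  have le {a b : H} (e : f a = f b) : a ≤ b := by
    rw [← himp_eq_top_iff]
    exact h _ (by rw [map_himp, e, himp_self])
  exact fun a b e => le_antisymm (le e) (le e.symm)

/-- Quotients by filters that are maximal with respect to omitting an element are subdirectly
irreducible. -/
theorem IsHeytingFilter.isSubdirectlyIrreducible_quotient {H : HeytAlg.{u}} {c : H} {F : Set H}
    (hF : IsHeytingFilter F) (hmax : Maximal (fun F => IsHeytingFilter F ∧ c ∉ F) F) :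
    IsSubdirectlyIrreducible hF.quotient := by
  intro ι B f hsurj hinj
  have hne : hF.proj c ≠ ⊤ := fun h => hmax.prop.2 (hF.proj_eq_top_iff.1 h)
  -- This also excludes the empty index set.
  obtain ⟨i, hi⟩ : ∃ i, f i (hF.proj c) ≠ ⊤ := by
    by_contra! h
    exact hne (hinj (funext fun i => (h i).trans (map_top (f i)).symm))
  refine ⟨i, HeytingHom.injective_of_eq_top _ fun b hb => ?_, hsurj i⟩
  obtain ⟨a, rfl⟩ := hF.proj_surjective b
  rw [hF.proj_eq_top_iff]
  -- The elements of `H` sent to `⊤` by coordinate `i` form a filter that contains `F` and omits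
  -- `c`, so by maximality it is `F`.
  refine hmax.2 ⟨IsHeytingFilter.preimage_top ((f i).comp hF.proj), hi⟩ (fun x hx => ?_) hb
  change f i (hF.proj x) = ⊤
  rw [hF.proj_eq_top_iff.2 hx, map_top]

/-- Birkhoff's subdirect representation: elements other than `⊤` are separated from `⊤` by
subdirectly irreducible quotients. -/
theorem exists_subdirectlyIrreducible_quotient {A : HeytAlg.{u}} {c : A} (hc : c ≠ ⊤) :
    ∃ (B : HeytAlg.{u}) (f : HeytingHom A B), Function.Surjective f ∧
      IsSubdirectlyIrreducible B ∧ f c ≠ ⊤ := by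
  obtain ⟨F, hmax⟩ := IsHeytingFilter.exists_maximal hc
  have hF := hmax.prop.1
  exact ⟨hF.quotient, hF.proj, hF.proj_surjective, hF.isSubdirectlyIrreducible_quotient hmax,
    fun h => hmax.prop.2 (hF.proj_eq_top_iff.1 h)⟩

/-- A variety contains every algebra whose subdirectly irreducible quotients it contains. -/
theorem IsHeytingVariety.mem_of_quotients {𝒱 : Set HeytAlg.{u}} (h𝒱 : IsHeytingVariety 𝒱)
    {A : HeytAlg.{u}} (h : ∀ (B : HeytAlg.{u}) (f : HeytingHom A B), Function.Surjective f →
      IsSubdirectlyIrreducible B → B ∈ 𝒱) : A ∈ 𝒱 := by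
  -- One factor for each `c ≠ ⊤` separates enough and keeps the index set in universe `u`.
  choose B f hsurj hirr hne using
    fun c : {c : A // c ≠ ⊤} => exists_subdirectlyIrreducible_quotient c.2
  let g : HeytingHom A (HeytAlg.of (∀ c, B c)) :=
    { toFun := fun a c => f c a
      map_sup' := fun a b => funext fun c => map_sup (f c) a b
      map_inf' := fun a b => funext fun c => map_inf (f c) a b
      map_bot' := funext fun c => map_bot (f c)
      map_himp' := fun a b => funext fun c => map_himp (f c) a b }
  refine h𝒱.subalgebra _ A g (h𝒱.product _ B fun c => h _ (f c) (hsurj c) (hirr c))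
    (g.injective_of_eq_top fun a ha => ?_)
  by_contra hn
  exact hne ⟨a, hn⟩ (congrFun ha ⟨a, hn⟩)

/-- Every `χ`-variety is the smallest `χ`-variety that contains its core generated subdirectly
irreducible members. -/
theorem mainTheorem8 {AP : Type v} (p : AP) (χ : PropFormula AP) (hχ : χ.vars ⊆ {p})
    (𝒳 : Set HeytAlg.{u}) (h𝒳 : IsChiVariety p χ 𝒳) :
    IsLeast {𝒴 : Set HeytAlg.{u} | IsChiVariety p χ 𝒴 ∧ coreGenSubdirIrred p χ 𝒳 ⊆ 𝒴} 𝒳 := by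
  refine ⟨⟨h𝒳, fun _ h => h.1⟩, ?_⟩
  obtain ⟨𝒱, h𝒱, rfl⟩ := h𝒳
  rintro _ ⟨⟨𝒲, h𝒲, rfl⟩, hsub⟩ K ⟨H, hH, hHK⟩
  have hS := IsHeytingSubalgebra.heytingClosure (χ.core p H)
  have hgen : IsCoreGenerated p χ hS.toHeytAlg := isCoreGenerated_heytingClosure_core hχ H
  have hG𝒱 : hS.toHeytAlg ∈ 𝒱 := h𝒱.subalgebra H _ hS.subtype hH hS.subtype_injective
  have hG𝒲 : hS.toHeytAlg ∈ 𝒲 := h𝒲.mem_of_quotients fun B f hf hB =>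
    have hgB := hgen.of_surjective f hf
    h𝒲.mem_of_mem_chiClosure
      (hsub ⟨subset_chiClosure 𝒱 (h𝒱.homImage _ B f hG𝒱 hf), hgB, hB⟩) hgB
  exact ⟨_, hG𝒲, IsCoreSuperalgebra.trans ⟨hS.subtype, hS.subtype_injective,
    image_core_subtype hχ hS (subset_heytingClosure _)⟩ hHK⟩
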